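/- Let $X$ be a separable infinite-dimensional Banach space over $\mathbb{R}$ or $\mathbb{C}$. For $K\ge 1$ and $N \ge 2$, say that bounded linear operators $T_1,\dots,T_N$ on $X$ satisfy condition $(B_K)$ if for all non-empty open sets $W, U_{1-K},\dots,U_0,U_1,\dots,U_N\subseteq X$ with $0\in W$ there is an integer $n\ge 1$ such that $$W\cap T_1^{-n}(U_1)\cap\cdots\cap T_N^{-n}(U_N)\neq\emptyset \quad\text{and}\quad U_\ell\cap T_1^{-n}(W)\cap\cdots\cap T_N^{-n}(W)\neq\emptyset \ \text{ for all integers } 1-K\le \ell\le 0,$$ where $T_i^{-n}(A)=\{x\in X: T_i^n x\in A\}$. The operators satisfy the \emph{Disjoint Blow-up/Collapse property} if $(B_1)$ holds, and the \emph{Strong Disjoint Blow-up/Collapse property} if $(B_K)$ holds for every integer $K\ge 1$. Then there exist bounded linear operators $T_1,T_2$ on $X$ that satisfy the Disjoint Blow-up/Collapse property but do not satisfy the Strong Disjoint Blow-up/Collapse property. -/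

import Mathlib

/-- The blow-up/collapse condition for the operators `T 0, …, T (N - 1)` with a family of `K`
open sets `V 0, …, V (K - 1)` to be collapsed: whenever `W` is an open neighbourhood of `0` and
all `V l`, `U i` are non-empty open sets, one and the same `n ≥ 1` gives a point of `W` that the
powers `T i ^ n` send into the `U i`, and for every `l` a point of `V l` that all the powers
`T i ^ n` send into `W`. -/
def DisjointBlowUpCollapseOfSize {𝕜 X : Type*} [RCLike 𝕜] [NormedAddCommGroup X]
    [NormedSpace 𝕜 X] {N : ℕ} (T : Fin N → X →L[𝕜] X) (K : ℕ) : Prop :=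
  ∀ (W : Set X) (V : Fin K → Set X) (U : Fin N → Set X),
    IsOpen W → (0 : X) ∈ W →
    (∀ l, IsOpen (V l) ∧ (V l).Nonempty) →
    (∀ i, IsOpen (U i) ∧ (U i).Nonempty) →
    ∃ n : ℕ, 1 ≤ n ∧
      (W ∩ ⋂ i, (⇑(T i ^ n)) ⁻¹' (U i)).Nonempty ∧
      ∀ l, (V l ∩ ⋂ i, (⇑(T i ^ n)) ⁻¹' W).Nonempty

/-- The Disjoint Blow-up/Collapse property. -/
def DisjointBlowUpCollapse {𝕜 X : Type*} [RCLike 𝕜] [NormedAddCommGroup X]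
    [NormedSpace 𝕜 X] {N : ℕ} (T : Fin N → X →L[𝕜] X) : Prop :=
  DisjointBlowUpCollapseOfSize T 1

/-- The Strong Disjoint Blow-up/Collapse property. -/
def StrongDisjointBlowUpCollapse {𝕜 X : Type*} [RCLike 𝕜] [NormedAddCommGroup X]
    [NormedSpace 𝕜 X] {N : ℕ} (T : Fin N → X →L[𝕜] X) : Prop :=
  ∀ K : ℕ, 1 ≤ K → DisjointBlowUpCollapseOfSize T K

/-!
The pair consists of an operator `T` and its conjugate by `R = 1 + ∑ i, f i ⊗ e i`, where the
functionals `f i`, `i < m`, have a biorthogonal family and the vectors `e i` are small enough for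
`R` to be invertible. Since `R ((R⁻¹ T R)ⁿ x) = Tⁿ x + ∑ i, f i x • Tⁿ (e i)`, the second orbit
differs from the first, up to `R`, only through the values `f i x`. Collapsing points close to the
`m` vectors dual to the `f i` forces all `Tⁿ (e i)` to be small, and then no point near `0` is
sent close to `0` by `Tⁿ` and far from `0` by `(R⁻¹ T R)ⁿ`. If there are only `K < m` points to
collapse, some combination of the `f i` kills them all but not a suitable small vector; for `T`
mixing and `e` universal, `n` can be chosen so that the `Tⁿ (e i)` follow the coefficients of that
combination. Hence the pair has the property for `K` exactly when `K < m`.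

A mixing `T` is `1 + S` for a weighted backward shift `S` along a biorthogonal sequence with dense
span: scaled falling factorials turn `1 + S` into the translation `p(X) ↦ p(X + 1)` of polynomials,
which is mixing for the topology pulled back along any linear map to a normed space.
-/

open Asymptotics Bornology Filter Polynomial Topology

section Biorthogonal

variable {𝕜 E : Type*} [RCLike 𝕜] [NormedAddCommGroup E] [NormedSpace 𝕜 E]

/-- Biorthogonality of a family of functionals `f` and a family of vectors `x`; neither family is
required to be total. -/
def IsBiorthogonal {ι : Type*} [DecidableEq ι] (f : ι → StrongDual 𝕜 E) (x : ι → E) : Prop :=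
  ∀ i j, f i (x j) = if i = j then 1 else 0

theorem finiteDimensional_of_dense_span {s : Set E} (hs : s.Finite)
    (hd : Dense (Submodule.span 𝕜 s : Set E)) : FiniteDimensional 𝕜 E := by
  have := FiniteDimensional.span_of_finite 𝕜 hs
  have htop : Submodule.span 𝕜 s = ⊤ := by
    rw [← (Submodule.span 𝕜 s).closed_of_finiteDimensional.submodule_topologicalClosure_eq,
      ← Submodule.dense_iff_topologicalClosure_eq_top]
    exact hd
  exact ⟨htop ▸ Submodule.fg_span hs⟩

theorem exists_linearIndependent_dense_span [TopologicalSpace.SeparableSpace E]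
    (hE : ¬ FiniteDimensional 𝕜 E) :
    ∃ x : ℕ → E, LinearIndependent 𝕜 x ∧ Dense (Submodule.span 𝕜 (Set.range x) : Set E) := by
  obtain ⟨κ, a, ha, hspan, hli⟩ := exists_linearIndependent' 𝕜 (TopologicalSpace.denseSeq E)
  set x : κ → E := TopologicalSpace.denseSeq E ∘ a
  have hd : Dense (Submodule.span 𝕜 (Set.range x) : Set E) := by
    rw [hspan]
    exact (TopologicalSpace.denseRange_denseSeq E).mono Submodule.subset_span
  have : Countable κ := ha.countable
  have : Infinite κ := by
    by_contra hfin
    rw [not_infinite_iff_finite] at hfin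
    exact hE (finiteDimensional_of_dense_span (Set.finite_range x) hd)
  obtain ⟨e⟩ : Nonempty (ℕ ≃ κ) := nonempty_equiv_of_countable
  refine ⟨x ∘ e, hli.comp e e.injective, ?_⟩
  rwa [e.surjective.range_comp]

theorem exists_dual_eq_one_of_notMem {F : Submodule 𝕜 E} (hF : IsClosed (F : Set E)) {x : E}
    (hx : x ∉ F) : ∃ f : StrongDual 𝕜 E, (∀ y ∈ F, f y = 0) ∧ f x = 1 := by
  obtain ⟨g, hg⟩ := SeparatingDual.exists_eq_one (R := 𝕜)
    (mt (Submodule.Quotient.mk_eq_zero F).1 hx)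
  refine ⟨g ∘L F.mkQL, fun y hy => ?_, hg⟩
  simp [(Submodule.Quotient.mk_eq_zero F).2 hy]

theorem exists_dual_triangular {x : ℕ → E} (hx : LinearIndependent 𝕜 x) :
    ∃ f : ℕ → StrongDual 𝕜 E, (∀ i j, j < i → f i (x j) = 0) ∧ ∀ i, f i (x i) = 1 := by
  have (i : ℕ) : ∃ g : StrongDual 𝕜 E, (∀ j < i, g (x j) = 0) ∧ g (x i) = 1 := by
    let F := Submodule.span 𝕜 (x '' Set.Iio i)
    have : FiniteDimensional 𝕜 F :=
      FiniteDimensional.span_of_finite 𝕜 ((Set.finite_Iio i).image x)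
    obtain ⟨g, hgF, hgi⟩ := exists_dual_eq_one_of_notMem F.closed_of_finiteDimensional
      (hx.notMem_span_image (s := Set.Iio i) (x := i) (by simp))
    exact ⟨g, fun j hj => hgF _ (Submodule.subset_span ⟨j, hj, rfl⟩), hgi⟩
  choose f hf using this
  exact ⟨f, fun i j hij => (hf i).1 j hij, fun i => (hf i).2⟩

/-- The vectors of Markushevich's construction of a biorthogonal system: if `f` is triangular with
respect to `x`, subtracting from each `x n` its components along the earlier vectors makes the
result biorthogonal to `f` itself, so that the functionals need not be changed. -/
noncomputable def biorthogonalize (f : ℕ → StrongDual 𝕜 E) (x : ℕ → E) (n : ℕ) : E :=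
  x n - ∑ i : Fin n, f i (x n) • biorthogonalize f x i

theorem biorthogonalize_eq (f : ℕ → StrongDual 𝕜 E) (x : ℕ → E) (n : ℕ) :
    biorthogonalize f x n = x n - ∑ i ∈ Finset.range n, f i (x n) • biorthogonalize f x i := by
  rw [biorthogonalize, Finset.sum_range]

theorem isBiorthogonal_biorthogonalize {f : ℕ → StrongDual 𝕜 E} {x : ℕ → E}
    (h₀ : ∀ i j, j < i → f i (x j) = 0) (h₁ : ∀ i, f i (x i) = 1) :
    IsBiorthogonal f (biorthogonalize f x) := by
  intro i j
  induction j using Nat.strong_induction_on with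
  | _ j ih =>
    have hsum : ∑ l ∈ Finset.range j, f l (x j) * f i (biorthogonalize f x l) =
        if i < j then f i (x j) else 0 := by
      rw [Finset.sum_congr rfl fun l hl => by rw [ih l (Finset.mem_range.1 hl)]]
      simp
    rw [biorthogonalize_eq, map_sub, map_sum]
    simp only [map_smul, smul_eq_mul, hsum]
    rcases lt_trichotomy i j with hij | rfl | hij
    · simp [hij, hij.ne]
    · simp [h₁]
    · simp [hij.not_gt, hij.ne', h₀ i j hij]

theorem span_range_le_span_range_biorthogonalize (f : ℕ → StrongDual 𝕜 E) (x : ℕ → E) :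
    Submodule.span 𝕜 (Set.range x) ≤ Submodule.span 𝕜 (Set.range (biorthogonalize f x)) := by
  rw [Submodule.span_le]
  rintro _ ⟨n, rfl⟩
  have hmem (i : ℕ) : biorthogonalize f x i ∈ Submodule.span 𝕜 (Set.range (biorthogonalize f x)) :=
    Submodule.subset_span ⟨i, rfl⟩
  rw [SetLike.mem_coe, ← sub_add_cancel (x n) (∑ i ∈ Finset.range n, _), ← biorthogonalize_eq f x n]
  exact add_mem (hmem n) (Submodule.sum_mem _ fun i _ => Submodule.smul_mem _ _ (hmem i))

theorem exists_isBiorthogonal_dense_span [TopologicalSpace.SeparableSpace E]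
    (hE : ¬ FiniteDimensional 𝕜 E) :
    ∃ (f : ℕ → StrongDual 𝕜 E) (x : ℕ → E), IsBiorthogonal f x ∧
      Dense (Submodule.span 𝕜 (Set.range x) : Set E) := by
  obtain ⟨x, hx, hd⟩ := exists_linearIndependent_dense_span (𝕜 := 𝕜) hE
  obtain ⟨f, h₀, h₁⟩ := exists_dual_triangular hx
  exact ⟨f, biorthogonalize f x, isBiorthogonal_biorthogonalize h₀ h₁,
    hd.mono (span_range_le_span_range_biorthogonalize f x)⟩

theorem exists_weighted_backward_shift [CompleteSpace E] {f : ℕ → StrongDual 𝕜 E} {x : ℕ → E}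
    (hfx : IsBiorthogonal f x) :
    ∃ (w : ℕ → 𝕜) (S : E →L[𝕜] E), (∀ k, w k ≠ 0) ∧ S (x 0) = 0 ∧
      ∀ k, S (x (k + 1)) = w k • x k := by
  let A (k : ℕ) : E →L[𝕜] E := (f (k + 1)).smulRight (x k)
  have hw (k : ℕ) : ∃ w : 𝕜, w ≠ 0 ∧ ‖w • A k‖ ≤ (1 / 2) ^ k := by
    have hlim : Tendsto (fun w : 𝕜 => ‖w • A k‖) (𝓝[≠] 0) (𝓝 0) := by
      have hcont : Continuous fun w : 𝕜 => ‖w • A k‖ := by fun_prop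
      simpa using (hcont.tendsto 0).mono_left nhdsWithin_le_nhds
    exact (eventually_mem_nhdsWithin.and (hlim.eventually_le_const (by positivity))).exists
  choose w hw₀ hw using hw
  have hsum : Summable fun k => w k • A k := .of_norm_bounded summable_geometric_two hw
  have hS (j : ℕ) : HasSum (fun k => w k • A k (x j)) ((∑' k, w k • A k) (x j)) :=
    hsum.hasSum.mapL (ContinuousLinearMap.apply 𝕜 E (x j))
  refine ⟨w, ∑' k, w k • A k, hw₀, (hS 0).unique ?_, fun j => (hS (j + 1)).unique ?_⟩
  · simp [A, hfx _ _, hasSum_zero]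
  · convert hasSum_single j fun k hk => ?_ <;> simp_all [A, hfx _ _]

end Biorthogonal

section Mixing

variable {𝕜 E : Type*} [RCLike 𝕜] [NormedAddCommGroup E] [NormedSpace 𝕜 E]

/-- Topological mixing of a bounded operator, the form of transitivity that passes to all finite
direct sums `T ⊕ ⋯ ⊕ T`. -/
def IsTopologicallyMixing (T : E →L[𝕜] E) : Prop :=
  ∀ U V : Set E, IsOpen U → U.Nonempty → IsOpen V → V.Nonempty →
    ∀ᶠ n : ℕ in atTop, (U ∩ ⇑(T ^ n) ⁻¹' V).Nonempty

theorem continuous_apply_eval_C (Φ : 𝕜[X] →ₗ[𝕜] E) (P : 𝕜[X][X]) :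
    Continuous fun t : 𝕜 => Φ (P.eval (C t)) := by
  simp only [eval_eq_sum_range, ← C_pow, mul_comm _ (C _), ← smul_eq_C_mul, map_sum, map_smul]
  fun_prop

theorem taylor_X_pow_mul_one_sub_pow {s : 𝕜} (hs : s ≠ 0) (k : ℕ) :
    taylor s (X ^ k * (1 - C s⁻¹ * X) ^ (k + 1)) =
      C s⁻¹ * (-X) ^ (k + 1) * (1 + C s⁻¹ * X) ^ k := by
  have hC : C s⁻¹ * C s = 1 := by rw [← C_mul, inv_mul_cancel₀ hs, C_1]
  have h₁ : 1 - C s⁻¹ * (X + C s) = C s⁻¹ * -X := by linear_combination -hC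
  have h₂ : 1 + C s⁻¹ * X = C s⁻¹ * (X + C s) := by linear_combination -hC
  rw [taylor_mul, taylor_pow, taylor_pow, map_sub, taylor_mul, taylor_X, taylor_C, taylor_one,
    C_1, h₁, h₂, mul_pow, mul_pow]
  ring

theorem exists_tendsto_taylor_tendsto_zero (Φ : 𝕜[X] →ₗ[𝕜] E) (p : 𝕜[X]) :
    ∃ a : 𝕜 → 𝕜[X], Tendsto (fun s => Φ (a s)) (cobounded 𝕜) (𝓝 (Φ p)) ∧
      Tendsto (fun s => Φ (taylor s (a s))) (cobounded 𝕜) (𝓝 0) := by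
  have hlim (P : 𝕜[X][X]) :
      Tendsto (fun s => Φ (P.eval (C s⁻¹))) (cobounded 𝕜) (𝓝 (Φ (P.eval 0))) := by
    simpa [Function.comp_def] using
      ((continuous_apply_eval_C Φ P).tendsto 0).comp tendsto_inv₀_cobounded
  induction p using Polynomial.induction_on' with
  | add p q hp hq =>
    obtain ⟨a, ha, ha'⟩ := hp
    obtain ⟨b, hb, hb'⟩ := hq
    exact ⟨a + b, by simpa using ha.add hb, by simpa using ha'.add hb'⟩
  | monomial k c =>
    -- Near `0` this is `c • X ^ k`, while its translate by `s` carries the factor `s⁻¹`.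
    refine ⟨fun s => c • (X ^ k * (1 - C s⁻¹ * X) ^ (k + 1)), ?_, ?_⟩
    · rw [← C_mul_X_pow_eq_monomial, ← smul_eq_C_mul]
      have h := (hlim (C X ^ k * (1 - X * C X) ^ (k + 1))).const_smul c
      simp only [eval_mul, eval_pow, eval_sub, eval_one, eval_X, eval_C] at h
      simpa using h
    · have h₀ := (hlim (X * C ((-X) ^ (k + 1)) * (1 + X * C X) ^ k)).const_smul c
      simp only [eval_mul, eval_X, zero_mul, map_zero, smul_zero] at h₀
      refine h₀.congr' ?_
      filter_upwards [eventually_ne_cobounded 0] with s hs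
      simp [taylor_X_pow_mul_one_sub_pow hs]

theorem pow_apply_eq_taylor {T : E →L[𝕜] E} {Φ : 𝕜[X] →ₗ[𝕜] E}
    (hT : ∀ p, T (Φ p) = Φ (taylor 1 p)) (n : ℕ) (p : 𝕜[X]) :
    (T ^ n) (Φ p) = Φ (taylor (n : 𝕜) p) := by
  induction n generalizing p with
  | zero => simp
  | succ n ih => rw [pow_succ, mul_apply_eq_comp, hT, ih, taylor_taylor, Nat.cast_succ]

theorem isTopologicallyMixing_of_taylor {T : E →L[𝕜] E} {Φ : 𝕜[X] →ₗ[𝕜] E}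
    (hΦ : DenseRange Φ) (hT : ∀ p, T (Φ p) = Φ (taylor 1 p)) : IsTopologicallyMixing T := by
  intro U V hU hUne hV hVne
  obtain ⟨p, hp⟩ := hΦ.exists_mem_open hU hUne
  obtain ⟨q, hq⟩ := hΦ.exists_mem_open hV hVne
  obtain ⟨a, ha, ha'⟩ := exists_tendsto_taylor_tendsto_zero Φ p
  obtain ⟨b, hb, hb'⟩ := exists_tendsto_taylor_tendsto_zero Φ q
  have hn : Tendsto (fun n : ℕ => (n : 𝕜)) atTop (cobounded 𝕜) := tendsto_natCast_atTop_cobounded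
  have hn' : Tendsto (fun n : ℕ => -(n : 𝕜)) atTop (cobounded 𝕜) :=
    tendsto_neg_cobounded.comp hn
  let z (n : ℕ) : 𝕜[X] := a n + taylor (-(n : 𝕜)) (b (-n))
  have hz : Tendsto (fun n => Φ (z n)) atTop (𝓝 (Φ p)) := by
    simpa [z] using (ha.comp hn).add (hb'.comp hn')
  have hTz : Tendsto (fun n => (T ^ n) (Φ (z n))) atTop (𝓝 (Φ q)) := by
    simp only [z, pow_apply_eq_taylor hT, map_add, taylor_taylor, add_neg_cancel, taylor_zero]
    simpa using (ha'.comp hn).add (hb.comp hn')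
  filter_upwards [hz.eventually_mem (hU.mem_nhds hp), hTz.eventually_mem (hV.mem_nhds hq)]
    with n hUn hVn using ⟨Φ (z n), hUn, hVn⟩

theorem taylor_one_descPochhammer_succ (k : ℕ) :
    taylor 1 (descPochhammer 𝕜 (k + 1)) =
      descPochhammer 𝕜 (k + 1) + ((k : 𝕜) + 1) • descPochhammer 𝕜 k := by
  have hinv (p : 𝕜[X]) : taylor 1 (p.comp (X - 1)) = p := by
    simp [taylor_apply, comp_assoc]
  have h := congrArg (taylor 1) (descPochhammer_succ_comp_X_sub_one (R := 𝕜) k)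
  rw [hinv, map_sub, smul_eq_mul, ← Nat.cast_succ, ← nsmul_eq_mul, map_nsmul, hinv] at h
  rw [← Nat.cast_succ, Nat.cast_smul_eq_nsmul]
  exact (add_eq_of_eq_sub h).symm

theorem exists_sequence_taylor_one {w : ℕ → 𝕜} (hw : ∀ k, w k ≠ 0) :
    ∃ S : Polynomial.Sequence 𝕜, taylor 1 (S 0) = S 0 ∧
      ∀ k, taylor 1 (S (k + 1)) = S (k + 1) + w k • S k := by
  let c (k : ℕ) : 𝕜 := ∏ i ∈ Finset.range k, w i / (i + 1)
  have hc (k : ℕ) : c k ≠ 0 :=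
    Finset.prod_ne_zero_iff.2 fun i _ => div_ne_zero (hw i) (Nat.cast_add_one_ne_zero i)
  refine ⟨⟨fun k => c k • descPochhammer 𝕜 k, fun k => ?_⟩, ?_, fun k => ?_⟩
  · rw [smul_eq_C_mul, degree_C_mul (hc k), degree_eq_natDegree (monic_descPochhammer 𝕜 k).ne_zero,
      descPochhammer_natDegree]
  · change taylor 1 (c 0 • descPochhammer 𝕜 0) = c 0 • descPochhammer 𝕜 0
    simp
  · change taylor 1 (c (k + 1) • descPochhammer 𝕜 (k + 1)) =
      c (k + 1) • descPochhammer 𝕜 (k + 1) + w k • c k • descPochhammer 𝕜 k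
    have hck : c (k + 1) * (k + 1) = w k * c k := by
      have := Nat.cast_add_one_ne_zero (R := 𝕜) k
      simp only [c, Finset.prod_range_succ]
      field_simp
    rw [map_smul, taylor_one_descPochhammer_succ, smul_add, smul_smul, smul_smul, hck]

theorem isTopologicallyMixing_one_add_of_shift {x : ℕ → E} {S : E →L[𝕜] E} {w : ℕ → 𝕜}
    (hx : Dense (Submodule.span 𝕜 (Set.range x) : Set E)) (hw : ∀ k, w k ≠ 0)
    (hS₀ : S (x 0) = 0) (hS : ∀ k, S (x (k + 1)) = w k • x k) :
    IsTopologicallyMixing (1 + S) := by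
  obtain ⟨P, hP₀, hP⟩ := exists_sequence_taylor_one hw
  let B := P.basis fun k => (leadingCoeff_ne_zero.2 (P.ne_zero k)).isUnit
  have hB (k : ℕ) : B.constr 𝕜 x (P k) = x k := by
    rw [← B.constr_basis 𝕜 x k, Polynomial.Sequence.basis_eq_self]
  refine isTopologicallyMixing_of_taylor (Φ := B.constr 𝕜 x) ?_ fun p => ?_
  · rwa [DenseRange, ← LinearMap.coe_range, B.constr_range]
  · have h : (↑(1 + S) : E →ₗ[𝕜] E) ∘ₗ B.constr 𝕜 x = B.constr 𝕜 x ∘ₗ taylor 1 := by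
      refine B.ext fun k => ?_
      cases k <;> simp [B, hP₀, hP, hB, hS₀, hS]
    exact LinearMap.congr_fun h p

theorem exists_isTopologicallyMixing [CompleteSpace E] [TopologicalSpace.SeparableSpace E]
    (hE : ¬ FiniteDimensional 𝕜 E) : ∃ T : E →L[𝕜] E, IsTopologicallyMixing T := by
  obtain ⟨f, x, hfx, hx⟩ := exists_isBiorthogonal_dense_span (𝕜 := 𝕜) hE
  obtain ⟨w, S, hw, hS₀, hS⟩ := exists_weighted_backward_shift hfx
  exact ⟨1 + S, isTopologicallyMixing_one_add_of_shift hx hw hS₀ hS⟩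

end Mixing

section Universality

theorem dense_setOf_forall_mapClusterPt {X Y : Type*} [TopologicalSpace X] [BaireSpace X]
    [TopologicalSpace Y] [SecondCountableTopology Y] {F : ℕ → X → Y} (hF : ∀ n, Continuous (F n))
    (h : ∀ U V, IsOpen U → U.Nonempty → IsOpen V → V.Nonempty →
      ∃ᶠ n in atTop, (U ∩ F n ⁻¹' V).Nonempty) :
    Dense {x | ∀ y, MapClusterPt y atTop fun n => F n x} := by
  have hres (N : ℕ) {V : Set Y} (hV : IsOpen V) (hVne : V.Nonempty) :
      ∀ᶠ x in residual X, ∃ n ≥ N, F n x ∈ V := by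
    have heq : {x | ∃ n ≥ N, F n x ∈ V} = ⋃ n ≥ N, F n ⁻¹' V := by ext; simp
    refine residual_of_dense_open (heq ▸ isOpen_biUnion fun n _ => hV.preimage (hF n)) ?_
    refine dense_iff_inter_open.2 fun U hU hUne => ?_
    obtain ⟨n, hn, x, hxU, hxV⟩ := frequently_atTop.1 (h U V hU hUne hV hVne) N
    exact ⟨x, hxU, n, hn, hxV⟩
  have hB := TopologicalSpace.isBasis_countableBasis Y
  have hall : ∀ᶠ x in residual X, ∀ V ∈ TopologicalSpace.countableBasis Y,
      ∀ N, ∃ n ≥ N, F n x ∈ V :=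
    (eventually_countable_ball (TopologicalSpace.countable_countableBasis Y)).2 fun V hV =>
      eventually_countable_forall.2 fun N =>
        hres N (hB.isOpen hV) (TopologicalSpace.nonempty_of_mem_countableBasis hV)
  refine (dense_of_mem_residual hall).mono fun x hx y => ?_
  rw [hB.nhds_hasBasis.mapClusterPt_iff_frequently]
  exact fun V hV => frequently_atTop.2 (hx V hV.1)

variable {𝕜 E : Type*} [RCLike 𝕜] [NormedAddCommGroup E] [NormedSpace 𝕜 E]

theorem IsTopologicallyMixing.eventually_pi {ι : Type*} [Finite ι] {T : E →L[𝕜] E}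
    (hT : IsTopologicallyMixing T) {U V : Set (ι → E)} (hU : IsOpen U) (hUne : U.Nonempty)
    (hV : IsOpen V) (hVne : V.Nonempty) :
    ∀ᶠ n : ℕ in atTop, (U ∩ (fun e i => (T ^ n) (e i)) ⁻¹' V).Nonempty := by
  obtain ⟨a, ha⟩ := hUne
  obtain ⟨b, hb⟩ := hVne
  obtain ⟨A, hA, hAU⟩ := isOpen_pi_iff'.1 hU a ha
  obtain ⟨B, hB, hBV⟩ := isOpen_pi_iff'.1 hV b hb
  have hmix : ∀ᶠ n : ℕ in atTop, ∀ i, (A i ∩ ⇑(T ^ n) ⁻¹' B i).Nonempty :=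
    eventually_all.2 fun i => hT _ _ (hA i).1 ⟨_, (hA i).2⟩ (hB i).1 ⟨_, (hB i).2⟩
  filter_upwards [hmix] with n hn
  choose e he using hn
  exact ⟨e, hAU fun i _ => (he i).1, hBV fun i _ => (he i).2⟩

theorem IsTopologicallyMixing.dense_setOf_universal [CompleteSpace E]
    [TopologicalSpace.SeparableSpace E] {ι : Type*} [Finite ι] {T : E →L[𝕜] E}
    (hT : IsTopologicallyMixing T) :
    Dense {e : ι → E | ∀ z, MapClusterPt z atTop fun n i => (T ^ n) (e i)} := by
  have := UniformSpace.secondCountable_of_separable E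
  have := Fintype.ofFinite ι
  exact dense_setOf_forall_mapClusterPt (fun n => by fun_prop)
    fun U V hU hUne hV hVne => (hT.eventually_pi hU hUne hV hVne).frequently

end Universality

section ConjugatePair

variable {𝕜 E : Type*} [RCLike 𝕜] [NormedAddCommGroup E] [NormedSpace 𝕜 E]
variable {ι : Type*} [Fintype ι]

theorem IsTopologicallyMixing.eventually_nhds {T : E →L[𝕜] E} (hT : IsTopologicallyMixing T)
    {a b : E} {s : Set (E × E)} (hs : s ∈ 𝓝 (a, b)) :
    ∀ᶠ n : ℕ in atTop, ∃ x, (x, (T ^ n) x) ∈ s := by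
  obtain ⟨A, B, hA, haA, hB, hbB, hAB⟩ := mem_nhds_prod_iff'.1 hs
  filter_upwards [hT A B hA ⟨a, haA⟩ hB ⟨b, hbB⟩] with n ⟨x, hxA, hxB⟩
  exact ⟨x, hAB ⟨hxA, hxB⟩⟩

theorem conj_pow_apply {R : (E →L[𝕜] E)ˣ} {f : ι → StrongDual 𝕜 E} {e : ι → E}
    (hR : (R : E →L[𝕜] E) = 1 + ∑ i, (f i).smulRight (e i)) (T : E →L[𝕜] E) (n : ℕ) (x : E) :
    ((↑R⁻¹ * T * ↑R) ^ n) x = (↑R⁻¹ : E →L[𝕜] E) ((T ^ n) x + ∑ i, f i x • (T ^ n) (e i)) := by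
  have hRx : (R : E →L[𝕜] E) x = x + ∑ i, f i x • e i := by simp [hR]
  simp only [Units.conj_pow', mul_apply_eq_comp, hRx, map_add, map_sum, map_smul]

theorem eventually_exists_orbit_conj {T : E →L[𝕜] E} (hT : IsTopologicallyMixing T)
    {R : (E →L[𝕜] E)ˣ} {f : ι → StrongDual 𝕜 E} {e : ι → E}
    (hR : (R : E →L[𝕜] E) = 1 + ∑ i, (f i).smulRight (e i)) {l : Filter ℕ} (hl : l ≤ atTop)
    {z : ι → E} (hz : Tendsto (fun n i => (T ^ n) (e i)) l (𝓝 z)) {a b c : E}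
    (hc : (R : E →L[𝕜] E) c = b + ∑ i, f i a • z i) {s : Set (E × E × E)} (hs : s ∈ 𝓝 (a, b, c)) :
    ∀ᶠ n in l, ∃ x, (x, (T ^ n) x, ((↑R⁻¹ * T * ↑R) ^ n) x) ∈ s := by
  let G (q : (E × E) × (ι → E)) : E × E × E :=
    (q.1.1, q.1.2, (↑R⁻¹ : E →L[𝕜] E) (q.1.2 + ∑ i, f i q.1.1 • q.2 i))
  have hG : Continuous G := by fun_prop
  have hGz : G ((a, b), z) = (a, b, c) := by
    simp only [G, ← hc, ← mul_apply_eq_comp, Units.inv_mul, one_apply_eq_self]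
  have hpre : G ⁻¹' s ∈ 𝓝 (a, b) ×ˢ 𝓝 z := by
    rw [← nhds_prod_eq]
    exact hG.continuousAt (hGz ▸ hs)
  obtain ⟨t, ht, t', ht', hsub⟩ := mem_prod_iff.1 hpre
  filter_upwards [hl (hT.eventually_nhds ht), hz ht'] with n ⟨x, hx⟩ hn
  refine ⟨x, ?_⟩
  rw [conj_pow_apply hR]
  exact hsub (Set.mk_mem_prod hx hn)

theorem IsBiorthogonal.exists_sum_mul_eq_one [DecidableEq ι] {f : ι → StrongDual 𝕜 E} {g : ι → E}
    (hfg : IsBiorthogonal f g) {K : ℕ} (hK : K < Fintype.card ι) (v : Fin K → E) {W : Set E}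
    (hW : W ∈ 𝓝 0) :
    ∃ c : ι → 𝕜, (∀ l, ∑ i, f i (v l) * c i = 0) ∧ ∃ w ∈ W, ∑ i, f i w * c i = 1 := by
  let A : (ι → 𝕜) →ₗ[𝕜] Fin K → 𝕜 := (Matrix.of fun l i => f i (v l)).mulVecLin
  obtain ⟨c, hc, hc₀⟩ := (LinearMap.ker A).ne_bot_iff.1 <|
    A.ker_ne_bot_of_finrank_lt (by simpa using hK)
  obtain ⟨j, hj⟩ := Function.ne_iff.1 hc₀
  have hsmall : ∀ᶠ t : 𝕜 in 𝓝[≠] 0, t • g j ∈ W := by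
    have hcont : Continuous fun t : 𝕜 => t • g j := by fun_prop
    exact (hcont.tendsto' 0 0 (zero_smul 𝕜 (g j))).mono_left nhdsWithin_le_nhds hW
  obtain ⟨t, htW, ht⟩ := (hsmall.and eventually_mem_nhdsWithin).exists
  have ht : t ≠ 0 := ht
  have hj : c j ≠ 0 := hj
  refine ⟨(t * c j)⁻¹ • c, fun l => ?_, t • g j, htW, ?_⟩
  · have hl : ∑ i, f i (v l) * c i = 0 := congrFun (LinearMap.mem_ker.1 hc) l
    simp [mul_left_comm, ← Finset.mul_sum, hl]
  · simp [hfg _ _]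
    field_simp

theorem disjointBlowUpCollapseOfSize_conj [DecidableEq ι] {T : E →L[𝕜] E}
    (hT : IsTopologicallyMixing T) {R : (E →L[𝕜] E)ˣ} {f : ι → StrongDual 𝕜 E} {e g : ι → E}
    (hR : (R : E →L[𝕜] E) = 1 + ∑ i, (f i).smulRight (e i)) (hfg : IsBiorthogonal f g)
    (he : ∀ z, MapClusterPt z atTop fun n i => (T ^ n) (e i)) {K : ℕ}
    (hK : K < Fintype.card ι) :
    DisjointBlowUpCollapseOfSize ![T, ↑R⁻¹ * T * ↑R] K := by
  intro W V U hW hW₀ hV hU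
  choose v hv using fun l => (hV l).2
  choose u hu using fun i => (hU i).2
  obtain ⟨c, hcv, w, hwW, hcw⟩ := hfg.exists_sum_mul_eq_one hK v (hW.mem_nhds hW₀)
  obtain ⟨l, hl, hz⟩ := mapClusterPt_iff_ultrafilter.1
    (he fun i => c i • ((R : E →L[𝕜] E) (u 1) - u 0))
  have hw : (R : E →L[𝕜] E) (u 1) = u 0 + ∑ i, f i w • c i • ((R : E →L[𝕜] E) (u 1) - u 0) := by
    simp [smul_smul, ← Finset.sum_smul, hcw]
  have hv₀ (k : Fin K) : (R : E →L[𝕜] E) 0 =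
      0 + ∑ i, f i (v k) • c i • ((R : E →L[𝕜] E) (u 1) - u 0) := by
    simp [smul_smul, ← Finset.sum_smul, hcv]
  have hblow := eventually_exists_orbit_conj hT hR hl hz hw
    ((hW.prod ((hU 0).1.prod (hU 1).1)).mem_nhds ⟨hwW, hu 0, hu 1⟩)
  have hcollapse := eventually_all.2 fun k => eventually_exists_orbit_conj hT hR hl hz (hv₀ k)
    (((hV k).1.prod (hW.prod hW)).mem_nhds ⟨hv k, hW₀, hW₀⟩)
  obtain ⟨n, ⟨x, hxW, hxU₀, hxU₁⟩, hn, hn₁⟩ :=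
    (hblow.and (hcollapse.and (hl (eventually_ge_atTop 1)))).exists
  refine ⟨n, hn₁, ⟨x, hxW, Set.mem_iInter.2 (Fin.forall_fin_two.2 ⟨hxU₀, hxU₁⟩)⟩, fun k => ?_⟩
  obtain ⟨y, hyV, hy₀, hy₁⟩ := hn k
  exact ⟨y, hyV, Set.mem_iInter.2 (Fin.forall_fin_two.2 ⟨hy₀, hy₁⟩)⟩

theorem tendsto_zero_of_tendsto_sum_smul [DecidableEq ι] {α : Type*} {l : Filter α}
    {c : α → ι → ι → 𝕜} {a : α → ι → E}
    (hc : ∀ i j, Tendsto (fun t => c t i j) l (𝓝 (if j = i then 1 else 0)))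
    (h : ∀ i, Tendsto (fun t => ∑ j, c t i j • a t j) l (𝓝 0)) : Tendsto a l (𝓝 0) := by
  have hequiv : (fun t i => ∑ j, c t i j • a t j) ~[l] a := by
    refine isLittleO_pi.2 fun i => ?_
    have hsum : (fun t => ∑ j, (c t i j - if j = i then 1 else 0) • a t j) =o[l] a := by
      refine IsLittleO.fun_sum fun j _ => ?_
      have hcj : (fun t => c t i j - if j = i then 1 else 0) =o[l] fun _ => (1 : ℝ) :=
        (isLittleO_one_iff ℝ).2 (tendsto_sub_nhds_zero_iff.2 (hc i j))
      have haj : (fun t => a t j) =O[l] a :=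
        isBigO_of_le l fun t => norm_le_pi_norm (a t) j
      have hmul := hcj.norm_left.mul_isBigO haj.norm_norm
      exact (hmul.congr (by simp [norm_smul]) (by simp)).of_norm_norm
    simpa [sub_smul, Finset.sum_sub_distrib] using hsum
  exact hequiv.tendsto_nhds (tendsto_pi_nhds.2 h)

theorem DisjointBlowUpCollapseOfSize.exists_seq {N K : ℕ} {T : Fin N → E →L[𝕜] E}
    (h : DisjointBlowUpCollapseOfSize T K) (v : Fin K → E) (u : Fin N → E) :
    ∃ (n : ℕ → ℕ) (x : ℕ → E) (y : ℕ → Fin K → E),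
      Tendsto x atTop (𝓝 0) ∧
      (∀ i, Tendsto (fun k => (T i ^ n k) (x k)) atTop (𝓝 (u i))) ∧
      ∀ l, Tendsto (fun k => y k l) atTop (𝓝 (v l)) ∧
        ∀ i, Tendsto (fun k => (T i ^ n k) (y k l)) atTop (𝓝 0) := by
  have hball {a : ℕ → E} {b : E} (hab : ∀ k : ℕ, a k ∈ Metric.ball b (1 / (k + 1))) :
      Tendsto a atTop (𝓝 b) :=
    tendsto_iff_dist_tendsto_zero.2 <| squeeze_zero (fun _ => dist_nonneg)
      (fun k => (hab k).le) tendsto_one_div_add_atTop_nhds_zero_nat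
  have hk (k : ℕ) := h (Metric.ball 0 (1 / (k + 1))) (fun l => Metric.ball (v l) (1 / (k + 1)))
    (fun i => Metric.ball (u i) (1 / (k + 1))) Metric.isOpen_ball
    (Metric.mem_ball_self Nat.one_div_pos_of_nat)
    (fun l => ⟨Metric.isOpen_ball, Metric.nonempty_ball.2 Nat.one_div_pos_of_nat⟩)
    (fun i => ⟨Metric.isOpen_ball, Metric.nonempty_ball.2 Nat.one_div_pos_of_nat⟩)
  choose n _ hx hy using hk
  choose x hxW hxU using hx
  choose y hyV hyW using hy
  exact ⟨n, x, y, hball hxW, fun i => hball fun k => Set.mem_iInter.1 (hxU k) i,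
    fun l => ⟨hball fun k => hyV k l, fun i => hball fun k => Set.mem_iInter.1 (hyW k l) i⟩⟩

theorem not_disjointBlowUpCollapseOfSize_conj [Nontrivial E] {T : E →L[𝕜] E}
    {R : (E →L[𝕜] E)ˣ} {K : ℕ} {f : Fin K → StrongDual 𝕜 E} {e g : Fin K → E}
    (hR : (R : E →L[𝕜] E) = 1 + ∑ i, (f i).smulRight (e i)) (hfg : IsBiorthogonal f g) :
    ¬ DisjointBlowUpCollapseOfSize ![T, ↑R⁻¹ * T * ↑R] K := by
  intro h
  obtain ⟨b, hb⟩ := exists_ne (0 : E)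
  obtain ⟨n, x, y, hx, hTx, hy⟩ := h.exists_seq g ![0, b]
  have hdiff {p : ℕ → E} {b₀ b₁ : E} (h₀ : Tendsto (fun k => (T ^ n k) (p k)) atTop (𝓝 b₀))
      (h₁ : Tendsto (fun k => ((↑R⁻¹ * T * ↑R) ^ n k) (p k)) atTop (𝓝 b₁)) :
      Tendsto (fun k => ∑ i, f i (p k) • (T ^ n k) (e i)) atTop
        (𝓝 ((R : E →L[𝕜] E) b₁ - b₀)) := by
    refine ((((R : E →L[𝕜] E).continuous.tendsto b₁).comp h₁).sub h₀).congr fun k => ?_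
    simp [conj_pow_apply hR, ← mul_apply_eq_comp]
  have he : Tendsto (fun k i => (T ^ n k) (e i)) atTop (𝓝 0) := by
    refine tendsto_zero_of_tendsto_sum_smul (c := fun k l i => f i (y k l)) (fun l i => ?_)
      fun l => ?_
    · exact hfg i l ▸ ((f i).continuous.tendsto _).comp (hy l).1
    · simpa using hdiff ((hy l).2 0) ((hy l).2 1)
  have hsum : Tendsto (fun k => ∑ i, f i (x k) • (T ^ n k) (e i)) atTop (𝓝 0) := by
    simpa using tendsto_finsetSum Finset.univ fun i _ =>
      (((f i).continuous.tendsto 0).comp hx).smul (tendsto_pi_nhds.1 he i)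
  have hRb : (R : E →L[𝕜] E) b = 0 := by
    simpa using tendsto_nhds_unique (hdiff (hTx 0) (hTx 1)) hsum
  apply hb
  simpa [← mul_apply_eq_comp] using congrArg (↑R⁻¹ : E →L[𝕜] E) hRb

theorem IsTopologicallyMixing.exists_universal_unit [CompleteSpace E]
    [TopologicalSpace.SeparableSpace E] {T : E →L[𝕜] E} (hT : IsTopologicallyMixing T)
    (f : ι → StrongDual 𝕜 E) :
    ∃ (e : ι → E) (R : (E →L[𝕜] E)ˣ), (∀ z, MapClusterPt z atTop fun n i => (T ^ n) (e i)) ∧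
      (R : E →L[𝕜] E) = 1 + ∑ i, (f i).smulRight (e i) := by
  let P (e : ι → E) : E →L[𝕜] E := ∑ i, (f i).smulRight (e i)
  have hP : Continuous P := continuous_finsetSum _ fun i _ =>
    (ContinuousLinearMap.smulRightL 𝕜 E E (f i)).continuous.comp (continuous_apply i)
  have hsmall : IsOpen {e | ‖-P e‖ < 1} := isOpen_lt hP.neg.norm continuous_const
  obtain ⟨e, he, heP⟩ := hT.dense_setOf_universal.exists_mem_open hsmall ⟨0, by simp [P]⟩
  exact ⟨e, Units.oneSub (-P e) heP, he, by simp [P]⟩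

theorem corollary3p4_general [CompleteSpace E] [TopologicalSpace.SeparableSpace E]
    (hE : ¬ FiniteDimensional 𝕜 E) (K : ℕ) :
    ∃ T₁ T₂ : E →L[𝕜] E, DisjointBlowUpCollapseOfSize ![T₁, T₂] K ∧
      ¬ DisjointBlowUpCollapseOfSize ![T₁, T₂] (K + 1) := by
  have : Nontrivial E := by
    contrapose! hE
    infer_instance
  obtain ⟨T, hT⟩ := exists_isTopologicallyMixing hE
  obtain ⟨f, g, hfg, -⟩ := exists_isBiorthogonal_dense_span hE
  have hfg' : IsBiorthogonal (fun i : Fin (K + 1) => f i) (fun i => g i) :=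
    fun i j => by simp [hfg _ _, Fin.ext_iff]
  obtain ⟨e, R, he, hR⟩ := hT.exists_universal_unit fun i : Fin (K + 1) => f i
  have h₁ := disjointBlowUpCollapseOfSize_conj hT hR hfg' he (K := K) (by simp)
  have h₂ := not_disjointBlowUpCollapseOfSize_conj (T := T) hR hfg'
  exact ⟨T, _, h₁, h₂⟩

end ConjugatePair

theorem corollary3p4 {𝕜 X : Type*} [RCLike 𝕜] [NormedAddCommGroup X] [NormedSpace 𝕜 X]
    [CompleteSpace X] [TopologicalSpace.SeparableSpace X] (hX : ¬ FiniteDimensional 𝕜 X) :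
    ∃ T₁ T₂ : X →L[𝕜] X,
      DisjointBlowUpCollapse ![T₁, T₂] ∧ ¬ StrongDisjointBlowUpCollapse ![T₁, T₂] := by
  obtain ⟨T₁, T₂, h₁, h₂⟩ := corollary3p4_general hX 1
  exact ⟨T₁, T₂, h₁, fun h => h₂ (h 2 one_le_two)⟩
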